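/- Let $R$ be a discrete valuation ring with finite residue field, uniformizer $\pi$, and field of fractions $F$ of characteristic zero. Let $H$ be a subgroup of a finite group $G$. Let $M$ be an $R[H]$-lattice, that is, an $R[H]$-module that is finitely generated and torsion-free over $R$, and suppose that $FM=F\otimes_R M$ is free of rank $1$ over $F[H]$. Notation: for a finite group $\Gamma$ and an $R[\Gamma]$-lattice $N$ the associated order is $\mathfrak{A}(F[\Gamma],N)=\{\lambda\in F[\Gamma] : \lambda N\subseteq N\}$, where $N$ is viewed inside $FN=F\otimes_R N$. For a subgroup $P$, $\mathrm{Tr}_P=\sum_{k\in P}k$, and $\mathrm{ncl}_G(P)$ is the normal closure of $P$ in $G$. We write $\mathrm{Ind}_H^G N=R[G]\otimes_{R[H]}N$; the module $\mathrm{Ind}_H^G\mathfrak{A}(F[H],M)$ is identified with its image in $F[G]$ under the injective map $x\otimes a\mapsto xa$, and it is said to be a ring if this image is a subring of $F[G]$. Suppose that there are integers $r\ge 0$ and $0=n_0<n_1<\cdots<n_r$ and subgroups $\{e\}=P_0\subsetneq P_1\subsetneq\cdots\subsetneq P_r\subseteq H$ such that $$\mathfrak{A}(F[H],M)=\sum_{i=0}^r\pi^{-n_i}R[H]\,\mathrm{Tr}_{P_i}.$$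 Then: 1. $\mathrm{Ind}_H^G\mathfrak{A}(F[H],M)=\sum_{i=0}^r\pi^{-n_i}R[G]\,\mathrm{Tr}_{P_i}$. 2. $\mathfrak{A}(F[G],\mathrm{Ind}_H^G M)=\sum_{i=0}^r\pi^{-n_i}R[G]\,\mathrm{Tr}_{\mathrm{ncl}_G(P_i)}$. 3. $\mathrm{Ind}_H^G\mathfrak{A}(F[H],M)$ is a ring if and only if $P_i$ is normal in $G$ for every $i$. 4. If $P_i$ is normal in $G$ for every $i$ and $M$ is free over $\mathfrak{A}(F[H],M)$, then $\mathrm{Ind}_H^G\mathfrak{A}(F[H],M)$ is stable under left multiplication by $\mathfrak{A}(F[G],\mathrm{Ind}_H^G M)$ and free over it, and $\mathrm{Ind}_H^G M$ is free over $\mathfrak{A}(F[G],\mathrm{Ind}_H^G M)$. 5. If $H$ is abelian and normal in $G$ and $\mathrm{Ind}_H^G M$ is projective over $\mathfrak{A}(F[G],\mathrm{Ind}_H^G M)$, then $P_i$ is normal in $G$ for every $i$. -/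

import Mathlib

open scoped TensorProduct MonoidAlgebra

noncomputable section

namespace GaloisLattice

section General

variable {R A V : Type*} [CommRing R] [Ring A] [Algebra R A] [AddCommGroup V] [Module R V]
  [Module A V] [IsScalarTower R A V]

variable (A) in
/-- The associated order `𝔄(A, L) = {a ∈ A : a L ⊆ L}` of an `R`-lattice `L` in an `A`-module. -/
def associatedOrder (L : Submodule R V) : Subalgebra R A where
  carrier := {a | ∀ x ∈ L, a • x ∈ L}
  mul_mem' := fun {a b} ha hb x hx => by
    rw [mul_smul]
    exact ha _ (hb _ hx)
  add_mem' := fun {a b} ha hb x hx => by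
    rw [add_smul]
    exact L.add_mem (ha _ hx) (hb _ hx)
  algebraMap_mem' := fun r x hx => by
    rw [algebraMap_smul]
    exact L.smul_mem r hx

variable (A) in
/-- The lattice `L`, regarded as a module over its associated order. -/
def latticeModule (L : Submodule R V) : Submodule (associatedOrder A L) V where
  carrier := L
  add_mem' := L.add_mem
  zero_mem' := L.zero_mem
  smul_mem' := fun a _ hx => a.2 _ hx

end General

section ExtendScalars

variable {R Γ M : Type*} (F : Type*) [CommRing R] [Group Γ] [AddCommGroup M] [Module R M]
  [Field F] [Algebra R F] (ρ : Representation R Γ M)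

/-- The `F`-linear action of `Γ` on `F ⊗[R] M` that extends an action on the `R`-module `M`. -/
def extendRep : Representation F Γ (F ⊗[R] M) :=
  (Module.End.baseChangeHom R F M : Module.End R M →* Module.End F (F ⊗[R] M)).comp ρ

/-- `FM`, that is `F ⊗[R] M`, with its structure of a module over the group algebra `F[Γ]`. -/
@[nolint unusedArguments]
def ScalarExt (_ρ : Representation R Γ M) : Type _ := F ⊗[R] M

instance : AddCommGroup (ScalarExt F ρ) := inferInstanceAs (AddCommGroup (F ⊗[R] M))

instance : Module F (ScalarExt F ρ) := inferInstanceAs (Module F (F ⊗[R] M))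

instance : Module R (ScalarExt F ρ) := inferInstanceAs (Module R (F ⊗[R] M))

instance : IsScalarTower R F (ScalarExt F ρ) := inferInstanceAs (IsScalarTower R F (F ⊗[R] M))

instance : Module F[Γ] (ScalarExt F ρ) :=
  Module.compHom (F ⊗[R] M) (extendRep F ρ).asAlgebraHom.toRingHom

theorem smul_def (a : F[Γ]) (x : F ⊗[R] M) :
    (a • (show ScalarExt F ρ from x)) = (extendRep F ρ).asAlgebraHom a x := rfl

instance : IsScalarTower R F[Γ] (ScalarExt F ρ) where
  smul_assoc r a x := by
    have h : (r • a : F[Γ]) = (algebraMap R F r) • a := (algebraMap_smul F r a).symm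
    rw [h, ← algebraMap_smul F r (a • x)]
    change (extendRep F ρ).asAlgebraHom _ _ = _ • (extendRep F ρ).asAlgebraHom _ _
    rw [map_smul]
    rfl

/-- The canonical map `m ↦ 1 ⊗ m` from `M` to `FM`. -/
def toScalarExt : M →ₗ[R] ScalarExt F ρ := TensorProduct.mk R F M 1

theorem single_smul_toScalarExt (g : Γ) (m : M) :
    (MonoidAlgebra.single g (1 : F)) • toScalarExt F ρ m = toScalarExt F ρ (ρ g m) := by
  change (extendRep F ρ).asAlgebraHom _ _ = _
  rw [Representation.asAlgebraHom_single, one_smul]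
  exact LinearMap.baseChange_tmul _ _ _

/-- `M` as an `R`-lattice in `FM`. It is isomorphic to `M` when `M` is torsion-free. -/
def lattice : Submodule R (ScalarExt F ρ) := LinearMap.range (toScalarExt F ρ)

/-- The associated order `𝔄(F[Γ], M)` of an `R[Γ]`-lattice `M`. -/
abbrev assocOrder : Subalgebra R F[Γ] := associatedOrder F[Γ] (lattice F ρ)

/-- `M` as a module over its associated order `𝔄(F[Γ], M)`. -/
abbrev assocModule : Submodule (assocOrder F ρ) (ScalarExt F ρ) :=
  latticeModule F[Γ] (lattice F ρ)

theorem single_mem_assocOrder (g : Γ) : MonoidAlgebra.single g (1 : F) ∈ assocOrder F ρ := by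
  rintro _ ⟨m, rfl⟩
  exact ⟨ρ g m, (single_smul_toScalarExt F ρ g m).symm⟩

/-- The action of `Γ` on `𝔄(F[Γ], M)` by left multiplication. -/
def assocOrderRep : Representation R Γ (assocOrder F ρ) where
  toFun g := LinearMap.mulLeft R ⟨MonoidAlgebra.single g 1, single_mem_assocOrder F ρ g⟩
  map_one' := by
    ext x : 2
    simp [← MonoidAlgebra.one_def]
  map_mul' g h := by
    ext x : 2
    simp [← mul_assoc, MonoidAlgebra.single_mul_single]

end ExtendScalars

section Induction

variable {R G M : Type*} (F : Type*) [CommRing R] [Group G] [AddCommGroup M] [Module R M]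
  [Field F] [Algebra R F] {H : Subgroup G} (ρ : Representation R H M)

/-- The induced `R[G]`-module `Ind_H^G M = R[G] ⊗_{R[H]} M`. -/
abbrev indRep : Representation R G (Representation.IndV H.subtype ρ) :=
  Representation.ind H.subtype ρ

/-- The canonical map `Ind_H^G 𝔄(F[H], M) → F[G]`, which is `x ⊗ a ↦ x a` on
`R[G] ⊗_{R[H]} 𝔄(F[H], M)`. Mathlib's `Representation.IndV` makes the tensor product out of the
left action of `H` on `R[G]`, so that its class of `g ⊗ a` is the element `g⁻¹ ⊗ a` here. -/
def indAssocMap : Representation.IndV H.subtype (assocOrderRep F ρ) →ₗ[R] F[G] :=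
  Representation.Coinvariants.lift _
    (TensorProduct.lift
      ((LinearMap.mul R F[G]).compl₁₂
        ((MonoidAlgebra.mapAlgHom G (Algebra.ofId R F)).toLinearMap ∘ₗ
          MonoidAlgebra.mapDomainLinearMap R R (fun g : G => g⁻¹))
        ((MonoidAlgebra.mapDomainAlgHom R F H.subtype).toLinearMap ∘ₗ
          (assocOrder F ρ).val.toLinearMap)))
    (fun h => by
      refine TensorProduct.ext (MonoidAlgebra.lhom_ext' fun g => ?_)
      refine LinearMap.ext_ring (LinearMap.ext fun a => ?_)
      have key : MonoidAlgebra.mapDomainAlgHom R F H.subtype (MonoidAlgebra.single h (1 : F)) =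
          MonoidAlgebra.single (h : G) (1 : F) := by
        simp
      simp [assocOrderRep, -MonoidAlgebra.mapDomainAlgHom_apply]
      rw [key, ← mul_assoc, MonoidAlgebra.single_mul_single]
      simp)

theorem indAssocMap_mk (g : G) (a : assocOrder F ρ) :
    indAssocMap F ρ (Representation.IndV.mk H.subtype (assocOrderRep F ρ) g a) =
      MonoidAlgebra.single g⁻¹ 1 * MonoidAlgebra.mapDomainAlgHom R F H.subtype (a : F[H]) := by
  simp [indAssocMap, -MonoidAlgebra.mapDomainAlgHom_apply]

/-- The canonical map is injective, so its range is a copy of `Ind_H^G 𝔄(F[H], M)`. -/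
theorem indAssocMap_injective : Function.Injective (indAssocMap F ρ) := by
  let Φ : ((G ⧸ H) →₀ assocOrder F ρ) →ₗ[R] Representation.IndV H.subtype (assocOrderRep F ρ) :=
    Finsupp.lsum R fun q => Representation.IndV.mk H.subtype (assocOrderRep F ρ) (q.out)⁻¹
  have hmk : ∀ (h : H) (g : G) (a : assocOrder F ρ),
      Representation.IndV.mk H.subtype (assocOrderRep F ρ) (h * g) (assocOrderRep F ρ h a) =
        Representation.IndV.mk H.subtype (assocOrderRep F ρ) g a := by
    intro h g a
    refine (Representation.Coinvariants.mk_eq_iff _).2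
      (Representation.Coinvariants.mem_ker_of_eq h (MonoidAlgebra.single g 1 ⊗ₜ a) _ ?_)
    simp
  have hsurj : Function.Surjective Φ := by
    have h0 : (LinearMap.range Φ).mkQ = 0 := by
      refine Representation.IndV.hom_ext _ _ fun g => LinearMap.ext fun a => ?_
      refine (Submodule.Quotient.mk_eq_zero _).2 ?_
      obtain ⟨h, hh⟩ := QuotientGroup.mk_out_eq_mul H g⁻¹
      refine ⟨Finsupp.single (g⁻¹ : G) (assocOrderRep F ρ h⁻¹ a), ?_⟩
      have h1 := hmk h⁻¹ g a
      rw [← h1]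
      simp only [Φ, Finsupp.lsum_single]
      rw [hh]
      simp
    rw [← LinearMap.range_eq_top, ← Submodule.ker_mkQ (LinearMap.range Φ), h0, LinearMap.ker_zero]
  have hcoeff : ∀ (f : (G ⧸ H) →₀ assocOrder F ρ) (q : G ⧸ H) (h : H),
      (indAssocMap F ρ (Φ f)).coeff (q.out * h) = (f q : F[H]).coeff h := by
    intro f q h
    induction f using Finsupp.induction_linear with
    | zero => simp
    | add f₁ f₂ h₁ h₂ => simp [h₁, h₂]
    | single q' a =>
      have h1 : Φ (Finsupp.single q' a) =
          Representation.IndV.mk H.subtype (assocOrderRep F ρ) (q'.out)⁻¹ a := by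
        simp only [Φ, Finsupp.lsum_single]
      have h2 : (indAssocMap F ρ (Φ (Finsupp.single q' a))).coeff (q.out * h) =
          (MonoidAlgebra.mapDomainAlgHom R F H.subtype (a : F[H])).coeff
            ((q'.out)⁻¹ * (q.out * h)) := by
        rw [h1, indAssocMap_mk, inv_inv, MonoidAlgebra.coeff_single_mul_apply, one_mul]
      rw [h2]
      by_cases hq : q' = q
      · subst hq
        rw [inv_mul_cancel_left, Finsupp.single_eq_same]
        exact Finsupp.mapDomain_apply H.subtype_injective _ _
      · rw [Finsupp.single_eq_of_ne (Ne.symm hq)]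
        refine Finsupp.mapDomain_of_notMem_range _ _ ?_
        rintro ⟨k, hk⟩
        refine hq ?_
        rw [← q'.out_eq', ← q.out_eq']
        refine Quotient.sound' (QuotientGroup.leftRel_apply.2 ?_)
        have h3 : (q'.out)⁻¹ * q.out = k * (h : G)⁻¹ := by
          rw [eq_mul_inv_iff_mul_eq, mul_assoc, ← hk]
          rfl
        rw [h3]
        exact H.mul_mem k.2 (H.inv_mem h.2)
  rw [← LinearMap.ker_eq_bot, LinearMap.ker_eq_bot']
  intro x hx
  obtain ⟨f, rfl⟩ := hsurj x
  have : f = 0 := by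
    ext q : 1
    refine Subtype.ext (MonoidAlgebra.ext (Finsupp.ext fun h => ?_))
    rw [← hcoeff f q h, hx]
    rfl
  rw [this, map_zero]

/-- `Ind_H^G 𝔄(F[H], M)`, regarded as an `R`-submodule of `F[G]`. -/
def indAssocOrder : Submodule R F[G] := LinearMap.range (indAssocMap F ρ)

end Induction

section Traces

variable {R Γ : Type*} (F : Type*) [CommRing R] [Group Γ] [Finite Γ] [Field F] [Algebra R F]

/-- The trace element `Tr_P = ∑_{k ∈ P} k`. -/
def trace (P : Subgroup Γ) : F[Γ] := ∑ᶠ k : P, MonoidAlgebra.single (k : Γ) 1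

/-- The `R`-submodule `π^{-n} R[Γ] Tr_P` of `F[Γ]`. -/
def traceModule (π : R) (n : ℕ) (P : Subgroup Γ) : Submodule R F[Γ] :=
  LinearMap.range
    (LinearMap.mulRight R (((algebraMap R F π) ^ n)⁻¹ • trace F P) ∘ₗ
      (MonoidAlgebra.mapAlgHom Γ (Algebra.ofId R F)).toLinearMap)

/-- The `R`-submodule `∑ i, π^{-n_i} R[Γ] Tr_{P_i}` of `F[Γ]`. -/
def traceSum {r : ℕ} (π : R) (n : Fin (r + 1) → ℕ) (P : Fin (r + 1) → Subgroup Γ) :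
    Submodule R F[Γ] :=
  ⨆ i, traceModule F π (n i) (P i)

end Traces

end GaloisLattice

end

/-! A trivialization `FM ≅ F[H]` turns `M` into a lattice `X ⊆ F[H]` and `Ind_H^G M` into `⨁ gX ⊆
F[G]` (`indTrivEquiv_mem`). An element `a` maps each `gX` into `⨁ g'X` exactly when every `ag` lies
in `Ind 𝔄(F[H], M)` (`mem_assocOrder_indRep_iff`). So the associated order of the induced lattice is
the largest part of `Ind 𝔄(F[H], M)` that is stable under right translation by `G`.

Sums of trace modules are described by coefficients (`mem_traceSum`): values in `π^{-n_r}R`,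
constant modulo `π^{-n_i}R` on left cosets of `P_{i+1}`. These conditions can be checked on one
coset of `H` at a time, which gives claim 1. Stability under right translation replaces each `P_i`
by all its conjugates, hence by its normal closure, which gives claim 2.

If the induced module is a ring, it contains `G`, so it is stable under right translation. Then
`π^{-n_i} Tr_{P_i}` lies in the associated order, and comparing its coefficients at `1` and at an
element of `ncl(P_i)` outside `P_i` shows that no such element exists (`le_of_trace_mem_traceSum`).
Conversely, for normal `P_i` the induced module and the associated order coincide, so a basis of `M`
induces a basis of `Ind_H^G M`.

For claim 5, a dual basis of the projective lattice writes `1` as a sum of products `c_j l_j` in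
`F[G]`. Projecting to the commutative ring `F[H]` and multiplying by `a ∈ 𝔄(F[H], M)` puts `a` in
the associated order of `Ind_H^G M` (`incl_mem_assocOrder_indRep`). The coefficient comparison then
applies again. -/

noncomputable section

namespace GaloisLattice

/-! ### Trace modules described by coefficients -/

section TraceSum

variable {R Γ : Type*} (F : Type*) [CommRing R] [Field F] [Algebra R F]

/-- The fractional ideal `π^{-n} R` of `F`. -/
def fracIdeal (π : R) (n : ℕ) : Submodule R F :=
  Submodule.span R {((algebraMap R F π) ^ n)⁻¹}

theorem mem_fracIdeal {π : R} {n : ℕ} {x : F} :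
    x ∈ fracIdeal F π n ↔ ∃ r : R, algebraMap R F r * ((algebraMap R F π) ^ n)⁻¹ = x := by
  simp [fracIdeal, Submodule.mem_span_singleton, Algebra.smul_def]

theorem fracIdeal_mono {π : R} (hπ : algebraMap R F π ≠ 0) : Monotone (fracIdeal F π) := by
  intro m n hmn
  refine (Submodule.span_singleton_le_iff_mem _ _).2 ((mem_fracIdeal F).2 ⟨π ^ (n - m), ?_⟩)
  obtain ⟨d, rfl⟩ := Nat.exists_eq_add_of_le hmn
  rw [Nat.add_sub_cancel_left, map_pow, pow_add]
  field_simp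

/-- Otherwise a positive power of `π` would divide `1`. This is where the strict growth of the
exponents takes effect. -/
theorem inv_pow_notMem_fracIdeal [IsDomain R] [IsFractionRing R F] {π : R} (hπ : Irreducible π)
    {m n : ℕ} (hmn : m < n) : ((algebraMap R F π) ^ n)⁻¹ ∉ fracIdeal F π m := by
  intro h
  obtain ⟨r, hr⟩ := (mem_fracIdeal F).1 h
  have hπ0 : algebraMap R F π ≠ 0 :=
    (map_ne_zero_iff _ (IsFractionRing.injective R F)).2 hπ.ne_zero
  obtain ⟨d, rfl⟩ := Nat.exists_eq_add_of_lt hmn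
  have h1 : algebraMap R F (r * π ^ (d + 1)) = algebraMap R F 1 := by
    rw [map_mul, map_pow, map_one]
    rw [add_assoc, pow_add] at hr
    field_simp at hr
    exact hr
  have h2 := IsFractionRing.injective R F h1
  refine hπ.not_isUnit (IsUnit.of_mul_eq_one (r * π ^ d) ?_)
  rw [← h2]
  ring

variable [Group Γ] [Finite Γ]

theorem coeff_mul_trace (P : Subgroup Γ) (x : F[Γ]) (g : Γ) :
    (x * trace F P).coeff g = ∑ᶠ k : P, x.coeff (g * k) := by
  classical
  have := Fintype.ofFinite P
  rw [trace, finsum_eq_sum_of_fintype, finsum_eq_sum_of_fintype, Finset.mul_sum,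
    MonoidAlgebra.coeff_sum, Finsupp.finsetSum_apply]
  refine Fintype.sum_equiv (Equiv.inv P) _ _ fun k => ?_
  rw [MonoidAlgebra.coeff_mul_single_apply]
  simp

theorem coeff_trace (P : Subgroup Γ) (g : Γ) [Decidable (g ∈ P)] :
    (trace F P).coeff g = if g ∈ P then 1 else 0 := by
  classical
  have h := coeff_mul_trace F P 1 g
  rw [one_mul] at h
  have := Fintype.ofFinite P
  rw [h, finsum_eq_sum_of_fintype]
  split_ifs with hg
  · rw [Fintype.sum_eq_single (⟨g, hg⟩⁻¹ : P)]
    · simp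
    · intro k hk
      rw [MonoidAlgebra.one_def, MonoidAlgebra.coeff_single, Finsupp.single_apply, if_neg]
      intro h1
      exact hk (Subtype.ext (eq_inv_of_mul_eq_one_right h1.symm))
  · refine Finset.sum_eq_zero fun k _ => ?_
    rw [MonoidAlgebra.one_def, MonoidAlgebra.coeff_single, Finsupp.single_apply, if_neg]
    intro h1
    exact hg (by rw [eq_inv_of_mul_eq_one_left h1.symm]; exact P.inv_mem k.2)

/-- The elements of `π^{-n} R[Γ] Tr_P` are the functions on `Γ / P` with values in `π^{-n} R`. -/
theorem mem_traceModule {π : R} {n : ℕ} {P : Subgroup Γ} {x : F[Γ]} :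
    x ∈ traceModule F π n P ↔
      (∀ g, x.coeff g ∈ fracIdeal F π n) ∧ ∀ g, ∀ k ∈ P, x.coeff (g * k) = x.coeff g := by
  classical
  have := Fintype.ofFinite P
  constructor
  · rintro ⟨a, rfl⟩
    have key : ∀ g, ((LinearMap.mulRight R (((algebraMap R F π) ^ n)⁻¹ • trace F P) ∘ₗ
      (MonoidAlgebra.mapAlgHom Γ (Algebra.ofId R F)).toLinearMap) a).coeff g =
        (∑ k : P, algebraMap R F (a.coeff (g * k))) * ((algebraMap R F π) ^ n)⁻¹ := by
      intro g
      simp only [LinearMap.comp_apply, LinearMap.mulRight_apply, mul_smul_comm,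
        MonoidAlgebra.coeff_smul_apply, coeff_mul_trace, finsum_eq_sum_of_fintype, smul_eq_mul]
      rw [mul_comm]
      rfl
    refine ⟨fun g => ?_, fun g k hk => ?_⟩
    · rw [key, ← map_sum]
      exact (mem_fracIdeal F).2 ⟨_, rfl⟩
    · rw [key, key]
      congr 1
      refine Fintype.sum_equiv (Equiv.mulLeft ⟨k, hk⟩) _ _ fun k' => ?_
      simp [mul_assoc]
  · rintro ⟨h1, h2⟩
    choose f hf using fun g => (mem_fracIdeal F).1 (h1 g)
    have hout : ∀ g : Γ, ((g : Γ ⧸ P).out)⁻¹ * g ∈ P := fun g =>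
      QuotientGroup.leftRel_apply.1 (Quotient.exact' (QuotientGroup.out_eq' (g : Γ ⧸ P)))
    -- The preimage is supported on one representative of each left coset, so the sum over `gP` that
    -- computes a coefficient has a single nonzero term.
    refine ⟨.ofCoeff (Finsupp.ofSupportFinite
      (fun g => if (g : Γ ⧸ P).out = g then f g else 0) (Set.toFinite _)), ?_⟩
    refine MonoidAlgebra.ext (Finsupp.ext fun g => ?_)
    simp only [LinearMap.comp_apply, LinearMap.mulRight_apply, mul_smul_comm,
        MonoidAlgebra.coeff_smul_apply, coeff_mul_trace, finsum_eq_sum_of_fintype, smul_eq_mul]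
    rw [Fintype.sum_eq_single (⟨_, hout g⟩⁻¹ : P)]
    · rw [mul_comm]
      have h3 : g * (((⟨_, hout g⟩⁻¹ : P)) : Γ) = (g : Γ ⧸ P).out := by simp
      have h4 : x.coeff g = x.coeff (g : Γ ⧸ P).out := by
        rw [← h2 (g : Γ ⧸ P).out _ (hout g), mul_inv_cancel_left]
      rw [h3, h4, ← hf]
      congr 1
      refine (MonoidAlgebra.coeff_mapAlgHom _ _ _).trans ?_
      simp [Finsupp.ofSupportFinite_coe]
    · intro k hk
      refine (MonoidAlgebra.coeff_mapAlgHom _ _ _).trans ?_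
      rw [← map_zero (Algebra.ofId R F)]
      refine congrArg _ (if_neg ?_)
      intro h3
      refine hk (Subtype.ext ?_)
      have h5 : ((g * k : Γ) : Γ ⧸ P) = (g : Γ ⧸ P) := by simp
      rw [h5] at h3
      simp [h3]

variable {r : ℕ} {π : R} {n : Fin (r + 1) → ℕ} {P : Fin (r + 1) → Subgroup Γ}

/-- An element of `F[Γ]` is in `∑ i, π^{-n_i} R[Γ] Tr_{P_i}` if and only if its coefficients are
in `π^{-n_r} R` and are constant modulo `π^{-n_i} R` on left cosets of `P_{i+1}`. -/
theorem mem_traceSum (hπ : algebraMap R F π ≠ 0) (hn : Monotone n) (hP0 : P 0 = ⊥)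
    (hP : Monotone P) {x : F[Γ]} :
    x ∈ traceSum F π n P ↔ (∀ g, x.coeff g ∈ fracIdeal F π (n (Fin.last r))) ∧
      ∀ (i : Fin r) (g : Γ), ∀ k ∈ P i.succ,
        x.coeff (g * k) - x.coeff g ∈ fracIdeal F π (n i.castSucc) := by
  constructor
  · intro hx
    induction hx using Submodule.iSup_induction' with
    | mem j y hy =>
      obtain ⟨h1, h2⟩ := (mem_traceModule F).1 hy
      refine ⟨fun g => fracIdeal_mono F hπ (hn (Fin.le_last j)) (h1 g), fun i g k hk => ?_⟩
      -- Either `n_j ≤ n_i`, and both coefficients are already in `π^{-n_i}R`, or `P_{i+1} ≤ P_j`,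
      -- and they are equal.
      rcases le_or_gt j i.castSucc with hj | hj
      · exact Submodule.sub_mem _ (fracIdeal_mono F hπ (hn hj) (h1 _))
          (fracIdeal_mono F hπ (hn hj) (h1 _))
      · rw [h2 g k (hP (Fin.castSucc_lt_iff_succ_le.1 hj) hk), sub_self]
        exact Submodule.zero_mem _
    | zero => simp
    | add y z _ _ hy hz =>
      refine ⟨fun g => Submodule.add_mem _ (hy.1 g) (hz.1 g), fun i g k hk => ?_⟩
      have := Submodule.add_mem _ (hy.2 i g k hk) (hz.2 i g k hk)
      simpa [add_sub_add_comm] using this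
  · rintro ⟨h1, h2⟩
    -- Induction on the level `j` that bounds the denominators; the coset conditions are kept for
    -- all `i`.
    suffices h : ∀ (j : Fin (r + 1)) (x : F[Γ]),
        (∀ g, x.coeff g ∈ fracIdeal F π (n j)) →
        (∀ (i : Fin r) (g : Γ), ∀ k ∈ P i.succ,
          x.coeff (g * k) - x.coeff g ∈ fracIdeal F π (n i.castSucc)) →
        x ∈ traceSum F π n P from h _ x h1 h2
    clear h1 h2 x
    intro j
    induction j using Fin.induction with
    | zero =>
      intro x h1 _
      refine Submodule.mem_iSup_of_mem 0 ((mem_traceModule F).2 ⟨h1, fun g k hk => ?_⟩)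
      rw [hP0, Subgroup.mem_bot] at hk
      rw [hk, mul_one]
    | succ j ih =>
      intro x h1 h2
      -- `y` replaces each coefficient by the one at the representative of its left coset of
      -- `P_{j+1}`. It lies in the trace module of index `j+1`, and the coset condition for `i = j`
      -- bounds the denominators of `x - y` by `π^{n_j}`.
      let y : F[Γ] := .ofCoeff (Finsupp.ofSupportFinite
        (fun g => x.coeff (g : Γ ⧸ P j.succ).out) (Set.toFinite _))
      have hy0 : ∀ g, y.coeff g = x.coeff (g : Γ ⧸ P j.succ).out := fun g => rfl
      have hyP : ∀ g, ∀ k ∈ P j.succ, y.coeff (g * k) = y.coeff g := by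
        intro g k hk
        rw [hy0, hy0, QuotientGroup.mk_mul_of_mem g hk]
      have hy : y ∈ traceModule F π (n j.succ) (P j.succ) :=
        (mem_traceModule F).2 ⟨fun g => by rw [hy0]; exact h1 _, hyP⟩
      have hxy : x - y ∈ traceSum F π n P := by
        refine ih _ (fun g => ?_) (fun i g k hk => ?_)
        · rw [MonoidAlgebra.coeff_sub, Finsupp.sub_apply, hy0]
          have := h2 j (g : Γ ⧸ P j.succ).out (((g : Γ ⧸ P j.succ).out)⁻¹ * g)
            (QuotientGroup.leftRel_apply.1
              (Quotient.exact' (QuotientGroup.out_eq' (g : Γ ⧸ P j.succ))))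
          rwa [mul_inv_cancel_left] at this
        · have h3 : y.coeff (g * k) - y.coeff g ∈ fracIdeal F π (n i.castSucc) := by
            rcases le_or_gt i j with hij | hij
            · rw [hyP g k (hP (Fin.succ_le_succ_iff.2 hij) hk), sub_self]
              exact Submodule.zero_mem _
            · have h4 := fracIdeal_mono F hπ (hn (Fin.succ_le_castSucc_iff.2 hij))
              exact Submodule.sub_mem _ (h4 (by rw [hy0]; exact h1 _))
                (h4 (by rw [hy0]; exact h1 _))
          have := Submodule.sub_mem _ (h2 i g k hk) h3
          rw [MonoidAlgebra.coeff_sub, Finsupp.sub_apply, Finsupp.sub_apply]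
          rwa [sub_sub_sub_comm] at this
      rw [← sub_add_cancel x y]
      exact Submodule.add_mem _ hxy (Submodule.mem_iSup_of_mem j.succ hy)

end TraceSum

/-! ### The projection `F[G] → F[H]` and induced submodules -/

section Restrict

variable {F G : Type*} [Field F] [Group G]

/-- The inclusion of group algebras `F[H] → F[G]`. -/
def incl (F : Type*) [Field F] (H : Subgroup G) : F[H] →ₐ[F] F[G] :=
  MonoidAlgebra.mapDomainAlgHom F F H.subtype

/-- The projection `F[G] → F[H]` that forgets the coefficients outside of `H`. -/
def restrict (F : Type*) [Field F] (H : Subgroup G) : F[G] →ₗ[F] F[H] where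
  toFun := MonoidAlgebra.comapDomain H.subtype H.subtype_injective
  map_add' := MonoidAlgebra.comapDomain_add _ _
  map_smul' c x := by
    ext
    simp

variable {H : Subgroup G}

theorem coeff_restrict (x : F[G]) (h : H) : (restrict F H x).coeff h = x.coeff h :=
  DFunLike.congr_fun (MonoidAlgebra.coeff_comapDomain _ H.subtype_injective x) h

theorem incl_single (h : H) (c : F) :
    incl F H (MonoidAlgebra.single h c) = MonoidAlgebra.single (h : G) c :=
  MonoidAlgebra.mapDomain_single

theorem restrict_mul_incl (x : F[G]) (a : F[H]) :
    restrict F H (x * incl F H a) = restrict F H x * a := by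
  induction a using MonoidAlgebra.induction_linear with
  | zero => simp
  | add a b ha hb => rw [map_add, mul_add, map_add, ha, hb, mul_add]
  | single k c =>
    refine MonoidAlgebra.ext (Finsupp.ext fun h => ?_)
    rw [coeff_restrict, incl_single, MonoidAlgebra.coeff_mul_single_apply,
      MonoidAlgebra.coeff_mul_single_apply, coeff_restrict]
    rfl

theorem restrict_incl_mul (a : F[H]) (x : F[G]) :
    restrict F H (incl F H a * x) = a * restrict F H x := by
  induction a using MonoidAlgebra.induction_linear with
  | zero => simp
  | add a b ha hb => rw [map_add, add_mul, map_add, ha, hb, add_mul]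
  | single k c =>
    refine MonoidAlgebra.ext (Finsupp.ext fun h => ?_)
    rw [coeff_restrict, incl_single, MonoidAlgebra.coeff_single_mul_apply,
      MonoidAlgebra.coeff_single_mul_apply, coeff_restrict]
    rfl

theorem restrict_one : restrict F H 1 = 1 := by
  refine MonoidAlgebra.ext (Finsupp.ext fun h => ?_)
  rw [coeff_restrict, MonoidAlgebra.one_def, MonoidAlgebra.one_def]
  exact (Finsupp.single_apply_left H.subtype_injective 1 h (1 : F))

theorem restrict_incl (a : F[H]) : restrict F H (incl F H a) = a := by
  rw [← mul_one (incl F H a), restrict_incl_mul, restrict_one, mul_one]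

theorem restrict_single_mem (h : H) (c : F) :
    restrict F H (MonoidAlgebra.single (h : G) c) = MonoidAlgebra.single h c := by
  rw [← incl_single, restrict_incl]

theorem restrict_single_notMem {g : G} (hg : g ∉ H) (c : F) :
    restrict F H (MonoidAlgebra.single g c) = 0 := by
  refine MonoidAlgebra.ext (Finsupp.ext fun h => ?_)
  rw [coeff_restrict]
  exact Finsupp.single_eq_of_ne fun h1 => hg (h1 ▸ h.2)

theorem coeff_incl (a : F[H]) (h : H) : (incl F H a).coeff h = a.coeff h := by
  rw [← coeff_restrict, restrict_incl]

theorem coeff_incl_notMem (a : F[H]) {g : G} (hg : g ∉ H) : (incl F H a).coeff g = 0 := by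
  refine Finsupp.mapDomain_of_notMem_range _ _ ?_
  rintro ⟨k, rfl⟩
  exact hg k.2

/-- `F[G]` is free as a right `F[H]`-module on representatives of `G ⧸ H`; the terms are the parts
of `x` on the left cosets. -/
theorem eq_sum_incl_restrict [Fintype (G ⧸ H)] (x : F[G]) :
    x = ∑ q : G ⧸ H, MonoidAlgebra.single q.out 1 *
      incl F H (restrict F H (MonoidAlgebra.single (q.out)⁻¹ 1 * x)) := by
  refine MonoidAlgebra.ext (Finsupp.ext fun g => ?_)
  rw [MonoidAlgebra.coeff_sum, Finsupp.finsetSum_apply, Fintype.sum_eq_single (g : G ⧸ H)]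
  · have hg : ((g : G ⧸ H).out)⁻¹ * g ∈ H :=
      QuotientGroup.leftRel_apply.1 (Quotient.exact' (QuotientGroup.out_eq' (g : G ⧸ H)))
    rw [MonoidAlgebra.coeff_single_mul_apply, one_mul,
      coeff_incl _ (⟨_, hg⟩ : H), coeff_restrict, MonoidAlgebra.coeff_single_mul_apply]
    simp
  · intro q hq
    rw [MonoidAlgebra.coeff_single_mul_apply, one_mul]
    refine coeff_incl_notMem _ fun h => hq ?_
    rw [← q.out_eq']
    exact QuotientGroup.eq.2 h

theorem restrict_mul [Fintype (G ⧸ H)] (x y : F[G]) :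
    restrict F H (x * y) = ∑ q : G ⧸ H, restrict F H (x * MonoidAlgebra.single q.out 1) *
      restrict F H (MonoidAlgebra.single (q.out)⁻¹ 1 * y) := by
  conv_lhs => rw [eq_sum_incl_restrict (H := H) y, Finset.mul_sum, map_sum]
  refine Finset.sum_congr rfl fun q _ => ?_
  rw [← mul_assoc, restrict_mul_incl]

variable {R : Type*} [CommRing R] [Algebra R F]

theorem restrict_smul (c : R) (x : F[G]) : restrict F H (c • x) = c • restrict F H x := by
  rw [← algebraMap_smul F c x, map_smul, algebraMap_smul]

/-- The `R`-submodule `⨁ g N` of `F[G]`, where `g` runs over `G ⧸ H`, for an `R[H]`-submodule `N`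
of `F[H]`. -/
def indSub (N : Submodule R F[H]) : Submodule R F[G] where
  carrier := {x | ∀ g : G, restrict F H (MonoidAlgebra.single g 1 * x) ∈ N}
  add_mem' hx hy g := by
    rw [mul_add, map_add]
    exact N.add_mem (hx g) (hy g)
  zero_mem' g := by
    rw [mul_zero, map_zero]
    exact N.zero_mem
  smul_mem' c x hx g := by
    rw [mul_smul_comm, restrict_smul]
    exact N.smul_mem c (hx g)

variable {N : Submodule R F[H]}

theorem mem_indSub {x : F[G]} :
    x ∈ indSub N ↔ ∀ g : G, restrict F H (MonoidAlgebra.single g 1 * x) ∈ N :=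
  Iff.rfl

theorem single_mul_incl_mem_indSub (hN : ∀ (h : H), ∀ a ∈ N, MonoidAlgebra.single h 1 * a ∈ N)
    (g : G) {a : F[H]} (ha : a ∈ N) : MonoidAlgebra.single g 1 * incl F H a ∈ indSub N := by
  intro g'
  rw [← mul_assoc, restrict_mul_incl, MonoidAlgebra.single_mul_single, one_mul]
  by_cases hg : g' * g ∈ H
  · rw [restrict_single_mem ⟨_, hg⟩]
    exact hN _ _ ha
  · rw [restrict_single_notMem hg, zero_mul]
    exact N.zero_mem

theorem indSub_le [Finite G] {S : Submodule R F[G]}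
    (hS : ∀ (g : G), ∀ a ∈ N, MonoidAlgebra.single g 1 * incl F H a ∈ S) : indSub N ≤ S := by
  intro x hx
  have := Fintype.ofFinite (G ⧸ H)
  rw [eq_sum_incl_restrict (H := H) x]
  exact Submodule.sum_mem _ fun q _ => hS _ _ (hx _)

end Restrict

/-! ### Induction and right translation of trace sums -/

section TraceSum

variable {R F G : Type*} [CommRing R] [Field F] [Algebra R F] [Group G] {H : Subgroup G} {π : R} {r : ℕ} {n : Fin (r + 1) → ℕ}
  {P : Fin (r + 1) → Subgroup G}

/-- Since `P i ≤ H`, each left coset of `P i` lies in a single left coset of `H`, so the coefficient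
conditions separate over `G ⧸ H`. -/
theorem indSub_traceSum [Finite G] (hπ : algebraMap R F π ≠ 0) (hn : Monotone n) (hP0 : P 0 = ⊥)
    (hP : Monotone P) (hPH : ∀ i, P i ≤ H) :
    indSub (traceSum F π n fun i => (P i).subgroupOf H) = traceSum F π n P := by
  ext x
  have h0 : (P 0).subgroupOf H = ⊥ := by rw [hP0, Subgroup.bot_subgroupOf]
  have hmono : Monotone fun i => (P i).subgroupOf H := fun i j hij =>
    Subgroup.comap_mono (hP hij)
  simp only [mem_indSub, mem_traceSum F hπ hn h0 hmono, mem_traceSum F hπ hn hP0 hP,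
    coeff_restrict, MonoidAlgebra.coeff_single_mul_apply, one_mul]
  constructor
  · intro h
    refine ⟨fun g => ?_, fun i g k hk => ?_⟩
    · simpa using (h g⁻¹).1 1
    · simpa using (h g⁻¹).2 i 1 ⟨k, hPH _ hk⟩ hk
  · rintro ⟨h1, h2⟩ g
    refine ⟨fun h => h1 _, fun i h k hk => ?_⟩
    simpa [mul_assoc] using h2 i (g⁻¹ * h) k hk

theorem forall_mul_single_mem_traceSum [Finite G] (hπ : algebraMap R F π ≠ 0) (hn : Monotone n)
    (hP0 : P 0 = ⊥) (hP : Monotone P) {x : F[G]} :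
    (∀ g : G, x * MonoidAlgebra.single g 1 ∈ traceSum F π n P) ↔
      x ∈ traceSum F π n fun i => Subgroup.normalClosure (P i : Set G) := by
  have h0 : Subgroup.normalClosure (P 0 : Set G) = ⊥ := by
    rw [hP0, Subgroup.normalClosure_eq_bot_iff, Subgroup.coe_bot]
  have hmono : Monotone fun i => Subgroup.normalClosure (P i : Set G) := fun i j hij =>
    Subgroup.normalClosure_mono (hP hij)
  simp only [mem_traceSum F hπ hn h0 hmono, mem_traceSum F hπ hn hP0 hP,
    MonoidAlgebra.coeff_mul_single_apply, mul_one]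
  constructor
  · intro h
    refine ⟨fun g => by simpa using (h 1).1 g, fun i g k hk => ?_⟩
    -- The right periods of `x` modulo `π^{-n_i}R` form a subgroup, so it suffices that they contain
    -- the conjugates of `P_{i+1}`.
    let S : Subgroup G :=
      { carrier := {k | ∀ g, x.coeff (g * k) - x.coeff g ∈ fracIdeal F π (n i.castSucc)}
        mul_mem' := fun {a b} ha hb g => by
          have := Submodule.add_mem _ (hb (g * a)) (ha g)
          rwa [sub_add_sub_cancel, mul_assoc] at this
        one_mem' := fun g => by simp
        inv_mem' := fun {a} ha g => by
          have := Submodule.neg_mem _ (ha (g * a⁻¹))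
          rwa [neg_sub, inv_mul_cancel_right] at this }
    have hS : Subgroup.normalClosure (P i.succ : Set G) ≤ S := by
      refine (Subgroup.closure_le _).2 fun y hy g => ?_
      obtain ⟨a, ha, hay⟩ := Group.mem_conjugatesOfSet_iff.1 hy
      obtain ⟨c, rfl⟩ := isConj_iff.1 hay
      -- Translating by `c` and evaluating at `g * c` turns the period `a` into `c * a * c⁻¹`.
      have := (h c).2 i (g * c) a ha
      simpa [mul_assoc] using this
    exact hS hk g
  · rintro ⟨h1, h2⟩ g
    refine ⟨fun _ => h1 _, fun i y k hk => ?_⟩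
    have := h2 i (y * g⁻¹) (g * k * g⁻¹) (Subgroup.normalClosure_normal.conj_mem _
      (Subgroup.subset_normalClosure hk) _)
    simpa [mul_assoc] using this

theorem trace_mem_traceSum [Finite G] (i : Fin (r + 1)) :
    ((algebraMap R F π) ^ n i)⁻¹ • trace F (P i) ∈ traceSum F π n P :=
  Submodule.mem_iSup_of_mem i ⟨1, by simp⟩

/-- The traces of the `P_i` detect the subgroups. -/
theorem le_of_trace_mem_traceSum [IsDomain R] [IsFractionRing R F] [Finite G] (hπ : Irreducible π) (hn : StrictMono n)
    {Q : Fin (r + 1) → Subgroup G} (hQ0 : Q 0 = ⊥) (hQ : Monotone Q) (i : Fin (r + 1))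
    (h : ((algebraMap R F π) ^ n i)⁻¹ • trace F (P i) ∈ traceSum F π n Q) : Q i ≤ P i := by
  classical
  have hπ0 : algebraMap R F π ≠ 0 :=
    (map_ne_zero_iff _ (IsFractionRing.injective R F)).2 hπ.ne_zero
  rw [mem_traceSum F hπ0 hn.monotone hQ0 hQ] at h
  cases i using Fin.cases with
  | zero => simp [hQ0]
  | succ i =>
    intro k hk
    by_contra hkP
    -- The coefficients at `k` and `1` are `0` and `π^{-n_{i+1}}`, but they would have to agree
    -- modulo `π^{-n_i}R`.
    have h1 := h.2 i 1 k hk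
    simp only [MonoidAlgebra.coeff_smul_apply, coeff_trace, one_mul, if_neg hkP,
      if_pos (P i.succ).one_mem, smul_eq_mul, mul_one, mul_zero, zero_sub, neg_mem_iff] at h1
    exact inv_pow_notMem_fracIdeal F hπ (hn (Fin.castSucc_lt_succ (i := i))) h1

end TraceSum

/-! ### Lattices in `FM` and their associated orders -/

section ScalarExt

variable {R Γ M F : Type*} [CommRing R] [Group Γ] [AddCommGroup M] [Module R M]
  [Field F] [Algebra R F] {ρ : Representation R Γ M}

instance : IsScalarTower F F[Γ] (ScalarExt F ρ) where
  smul_assoc c a x := by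
    change (extendRep F ρ).asAlgebraHom _ _ = _ • (extendRep F ρ).asAlgebraHom _ _
    rw [map_smul]
    rfl

instance : SMulCommClass F F[Γ] (ScalarExt F ρ) :=
  IsScalarTower.to_smulCommClass

theorem scalarExt_induction {motive : ScalarExt F ρ → Prop}
    (add : ∀ x y, motive x → motive y → motive (x + y))
    (smul : ∀ (c : F) (m : M), motive (c • toScalarExt F ρ m)) (x : ScalarExt F ρ) :
    motive x := by
  refine TensorProduct.induction_on (motive := motive) x ?_ (fun c m => ?_) add
  · have := smul 0 0
    rwa [zero_smul] at this
  · have h : c ⊗ₜ[R] m = (c • ((1 : F) ⊗ₜ[R] m) : F ⊗[R] M) := by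
      rw [TensorProduct.smul_tmul', smul_eq_mul, mul_one]
    rw [h]
    exact smul c m

theorem toScalarExt_mem_lattice (m : M) : toScalarExt F ρ m ∈ lattice F ρ := ⟨m, rfl⟩

theorem exists_smul_mem_lattice [IsDomain R] [IsFractionRing R F] (x : ScalarExt F ρ) :
    ∃ s : R, s ≠ 0 ∧ s • x ∈ lattice F ρ := by
  induction x using scalarExt_induction with
  | add x y hx hy =>
    obtain ⟨s, hs, hx⟩ := hx
    obtain ⟨t, ht, hy⟩ := hy
    refine ⟨s * t, mul_ne_zero hs ht, ?_⟩
    rw [smul_add]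
    refine Submodule.add_mem _ ?_ ?_
    · rw [mul_comm, mul_smul]
      exact Submodule.smul_mem _ _ hx
    · rw [mul_smul]
      exact Submodule.smul_mem _ _ hy
  | smul c m =>
    obtain ⟨a, s, hs, rfl⟩ := IsFractionRing.div_surjective (A := R) c
    refine ⟨s, nonZeroDivisors.ne_zero hs, ?_⟩
    have hs0 : algebraMap R F s ≠ 0 :=
      (map_ne_zero_iff _ (IsFractionRing.injective R F)).2 (nonZeroDivisors.ne_zero hs)
    rw [← algebraMap_smul F s, smul_smul, mul_div_cancel₀ _ hs0, algebraMap_smul]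
    exact Submodule.smul_mem _ _ (toScalarExt_mem_lattice m)

/-- The associated order of a lattice in a free module of rank one, in terms of the image of the
lattice in the algebra. -/
theorem mem_associatedOrder_iff {A V : Type*} [Ring A] [Algebra R A] [AddCommGroup V] [Module R V]
    [Module A V] [IsScalarTower R A V] (e : V ≃ₗ[A] A) {L : Submodule R V} {N : Submodule R A}
    (h : ∀ x, e x ∈ N ↔ x ∈ L) {a : A} :
    a ∈ associatedOrder A L ↔ ∀ x ∈ N, a * x ∈ N := by
  constructor
  · intro ha x hx
    have := (h _).2 (ha (e.symm x) ((h _).1 (by simpa using hx)))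
    simpa using this
  · intro ha x hx
    rw [← h, map_smul]
    exact ha _ ((h _).2 hx)

end ScalarExt

/-! ### Trivializing the induced lattice -/

section Induction

variable {R F G M : Type*} [CommRing R] [Field F] [Algebra R F] [Group G] {H : Subgroup G}
  [AddCommGroup M] [Module R M] {ρ : Representation R H M}

theorem indMk_mul (h : H) (g : G) (m : M) :
    Representation.IndV.mk H.subtype ρ (h * g) (ρ h m) = Representation.IndV.mk H.subtype ρ g m := by
  refine (Representation.Coinvariants.mk_eq_iff _).2
    (Representation.Coinvariants.mem_ker_of_eq h (MonoidAlgebra.single g 1 ⊗ₜ m) _ ?_)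
  simp

theorem indRep_mk (g₁ g₂ : G) (m : M) :
    indRep ρ g₁ (Representation.IndV.mk H.subtype ρ g₂ m) =
      Representation.IndV.mk H.subtype ρ (g₂ * g₁⁻¹) m :=
  Representation.ind_mk _ _ _ _ _

theorem indRep_mk_one (h : H) (m : M) :
    indRep ρ (h : G) (Representation.IndV.mk H.subtype ρ 1 m) =
      Representation.IndV.mk H.subtype ρ 1 (ρ h m) := by
  rw [indRep_mk, ← indMk_mul h]
  simp

variable (F ρ) in
/-- The canonical map `FM → F Ind_H^G M`. -/
def toIndExt : ScalarExt F ρ →ₗ[F] ScalarExt F (indRep ρ) :=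
  LinearMap.baseChange F (Representation.IndV.mk H.subtype ρ 1)

theorem toIndExt_toScalarExt (m : M) : toIndExt F ρ (toScalarExt F ρ m) =
    toScalarExt F (indRep ρ) (Representation.IndV.mk H.subtype ρ 1 m) :=
  LinearMap.baseChange_tmul _ _ _

theorem incl_smul_toIndExt (a : F[H]) (x : ScalarExt F ρ) :
    incl F H a • toIndExt F ρ x = toIndExt F ρ (a • x) := by
  induction a using MonoidAlgebra.induction_linear with
  | zero => simp
  | add a b ha hb => rw [map_add, add_smul, add_smul, map_add, ha, hb]
  | single h c =>
    have hc : MonoidAlgebra.single h c = c • MonoidAlgebra.single h (1 : F) := by simp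
    rw [hc, map_smul, smul_assoc, smul_assoc, map_smul, incl_single]
    congr 1
    induction x using scalarExt_induction with
    | add x y hx hy => rw [map_add, smul_add, smul_add, map_add, hx, hy]
    | smul d m =>
      rw [map_smul, smul_comm, smul_comm _ d, map_smul, single_smul_toScalarExt,
        toIndExt_toScalarExt, toIndExt_toScalarExt, single_smul_toScalarExt, indRep_mk_one]

theorem single_smul_toIndExt (g : G) (m : M) :
    MonoidAlgebra.single g (1 : F) • toIndExt F ρ (toScalarExt F ρ m) =
      toScalarExt F (indRep ρ) (Representation.IndV.mk H.subtype ρ g⁻¹ m) := by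
  rw [toIndExt_toScalarExt, single_smul_toScalarExt, indRep_mk, one_mul]

theorem single_smul_toIndExt_mem_lattice (g : G) {x : ScalarExt F ρ} (hx : x ∈ lattice F ρ) :
    MonoidAlgebra.single g (1 : F) • toIndExt F ρ x ∈ lattice F (indRep ρ) := by
  obtain ⟨m, rfl⟩ := hx
  rw [single_smul_toIndExt]
  exact toScalarExt_mem_lattice _

/-- The lattice `Ind_H^G M` is spanned by the translates of `M`. -/
theorem lattice_indRep_le {S : Submodule R (ScalarExt F (indRep ρ))}
    (hS : ∀ (g : G), ∀ x ∈ lattice F ρ, MonoidAlgebra.single g (1 : F) • toIndExt F ρ x ∈ S) :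
    lattice F (indRep ρ) ≤ S := by
  rw [← Submodule.ker_mkQ S, lattice, LinearMap.range_le_ker_iff]
  refine Representation.IndV.hom_ext _ _ fun g => LinearMap.ext fun m => ?_
  have := hS g⁻¹ _ (toScalarExt_mem_lattice m)
  rw [single_smul_toIndExt, inv_inv] at this
  exact (Submodule.Quotient.mk_eq_zero _).2 this

variable (e : ScalarExt F ρ ≃ₗ[F[H]] F[H])

/-- The map `Ind_H^G M → F[G]` obtained from a trivialization of `FM`. -/
def indTriv : Representation.IndV H.subtype ρ →ₗ[R] F[G] :=
  Representation.Coinvariants.lift _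
    (TensorProduct.lift
      ((LinearMap.mul R F[G]).compl₁₂
        ((MonoidAlgebra.mapAlgHom G (Algebra.ofId R F)).toLinearMap ∘ₗ
          MonoidAlgebra.mapDomainLinearMap R R (fun g : G => g⁻¹))
        ((incl F H).toLinearMap.restrictScalars R ∘ₗ e.toLinearMap.restrictScalars R ∘ₗ
          toScalarExt F ρ)))
    (fun h => by
      refine TensorProduct.ext (MonoidAlgebra.lhom_ext' fun g => ?_)
      refine LinearMap.ext_ring (LinearMap.ext fun m => ?_)
      simp
      rw [← single_smul_toScalarExt, map_smul, smul_eq_mul, map_mul, incl_single, ← mul_assoc,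
        MonoidAlgebra.single_mul_single]
      simp)

theorem indTriv_mk (g : G) (m : M) :
    indTriv e (Representation.IndV.mk H.subtype ρ g m) =
      MonoidAlgebra.single g⁻¹ 1 * incl F H (e (toScalarExt F ρ m)) := by
  simp [indTriv]

/-- The `F`-linear extension of `indTriv`. -/
def indTrivExt : ScalarExt F (indRep ρ) →ₗ[F] F[G] := (indTriv e).liftBaseChange F

theorem indTrivExt_toScalarExt (x : Representation.IndV H.subtype ρ) :
    indTrivExt e (toScalarExt F (indRep ρ) x) = indTriv e x := by
  refine (LinearMap.liftBaseChange_tmul _ _ _ _).trans ?_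
  rw [one_smul]

theorem map_smul_of_equiv (c : F) (x : ScalarExt F ρ) : e (c • x) = c • e x := by
  rw [← one_smul F[H] x, ← smul_assoc, map_smul, map_smul, smul_assoc]

theorem indTrivExt_single_smul_toIndExt (g : G) (x : ScalarExt F ρ) :
    indTrivExt e (MonoidAlgebra.single g (1 : F) • toIndExt F ρ x) =
      MonoidAlgebra.single g 1 * incl F H (e x) := by
  induction x using scalarExt_induction with
  | add x y hx hy => rw [map_add, smul_add, map_add, map_add, map_add, mul_add, hx, hy]
  | smul d m =>
    rw [(toIndExt F ρ).map_smul, smul_comm, (indTrivExt e).map_smul, map_smul_of_equiv,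
      map_smul (incl F H), mul_smul_comm,
       single_smul_toIndExt, indTrivExt_toScalarExt, indTriv_mk, inv_inv]

theorem indTrivExt_smul_toIndExt (a : F[G]) (x : ScalarExt F ρ) :
    indTrivExt e (a • toIndExt F ρ x) = a * incl F H (e x) := by
  induction a using MonoidAlgebra.induction_linear with
  | zero => simp
  | add a b ha hb => rw [add_smul, map_add, add_mul, ha, hb]
  | single g c =>
    have hc : MonoidAlgebra.single g c = c • MonoidAlgebra.single g (1 : F) := by simp
    rw [hc, smul_assoc, map_smul, smul_mul_assoc, indTrivExt_single_smul_toIndExt]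

theorem smul_toIndExt_surjective (y : ScalarExt F (indRep ρ)) :
    ∃ a : F[G], a • toIndExt F ρ (e.symm 1) = y := by
  let Ψ : F[G] →ₗ[F] ScalarExt F (indRep ρ) :=
    (LinearMap.toSpanSingleton F[G] _ (toIndExt F ρ (e.symm 1))).restrictScalars F
  have h1 : lattice F (indRep ρ) ≤ (LinearMap.range Ψ).restrictScalars R := by
    refine lattice_indRep_le fun g x _ => ⟨MonoidAlgebra.single g 1 * incl F H (e x), ?_⟩
    change (MonoidAlgebra.single g 1 * incl F H (e x)) • toIndExt F ρ (e.symm 1) = _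
    rw [mul_smul, incl_smul_toIndExt, ← e.symm.map_smul, smul_eq_mul, mul_one, e.symm_apply_apply]
  suffices y ∈ LinearMap.range Ψ from this
  induction y using scalarExt_induction with
  | add x y hx hy => exact Submodule.add_mem _ hx hy
  | smul c m => exact Submodule.smul_mem _ _ (h1 (toScalarExt_mem_lattice m))

/-- `indTrivExt` is a left inverse of the orbit map; no dimension count is needed. -/
theorem smul_toIndExt_injective :
    Function.Injective fun a : F[G] => a • toIndExt F ρ (e.symm 1) := by
  intro a b hab
  have := congrArg (indTrivExt e) hab
  simpa only [indTrivExt_smul_toIndExt, e.apply_symm_apply, map_one, mul_one] using this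

/-- A trivialization of `FM` induces a trivialization of `F Ind_H^G M`. -/
def indTrivEquiv : ScalarExt F (indRep ρ) ≃ₗ[F[G]] F[G] :=
  (LinearEquiv.ofBijective (LinearMap.toSpanSingleton F[G] _ (toIndExt F ρ (e.symm 1)))
    ⟨smul_toIndExt_injective e, smul_toIndExt_surjective e⟩).symm

theorem indTrivEquiv_toIndExt (x : ScalarExt F ρ) :
    indTrivEquiv e (toIndExt F ρ x) = incl F H (e x) := by
  refine (LinearEquiv.symm_apply_eq _).2 ?_
  change _ = incl F H (e x) • toIndExt F ρ (e.symm 1)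
  rw [incl_smul_toIndExt, ← e.symm.map_smul, smul_eq_mul, mul_one, e.symm_apply_apply]

/-- The image of the lattice `M` under a trivialization of `FM`. -/
def trivLattice : Submodule R F[H] := (lattice F ρ).map (e.toLinearMap.restrictScalars R)

theorem apply_mem_trivLattice {x : ScalarExt F ρ} : e x ∈ trivLattice e ↔ x ∈ lattice F ρ := by
  refine ⟨?_, fun h => ⟨x, h, rfl⟩⟩
  rintro ⟨y, hy, hyx⟩
  rwa [← e.injective hyx]

theorem mem_assocOrder {a : F[H]} :
    a ∈ assocOrder F ρ ↔ ∀ x ∈ trivLattice e, a * x ∈ trivLattice e :=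
  mem_associatedOrder_iff e fun _ => apply_mem_trivLattice e

theorem single_mul_mem_trivLattice (h : H) (a : F[H]) (ha : a ∈ trivLattice e) :
    MonoidAlgebra.single h 1 * a ∈ trivLattice e :=
  (mem_assocOrder e).1 (single_mem_assocOrder F ρ h) a ha

variable [Finite G]

theorem indTrivEquiv_mem {x : ScalarExt F (indRep ρ)} :
    indTrivEquiv e x ∈ indSub (trivLattice e) ↔ x ∈ lattice F (indRep ρ) := by
  constructor
  · have h : indSub (trivLattice e) ≤ (lattice F (indRep ρ)).map
        ((indTrivEquiv e).toLinearMap.restrictScalars R) := by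
      refine indSub_le ?_
      rintro g _ ⟨y, hy, rfl⟩
      refine ⟨_, single_smul_toIndExt_mem_lattice g hy, ?_⟩
      refine ((indTrivEquiv e).map_smul _ _).trans ?_
      rw [indTrivEquiv_toIndExt]
      rfl
    intro hx
    obtain ⟨y, hy, hyx⟩ := h hx
    rwa [← (indTrivEquiv e).injective hyx]
  · have h : lattice F (indRep ρ) ≤ (indSub (trivLattice e)).comap
        ((indTrivEquiv e).toLinearMap.restrictScalars R) := by
      refine lattice_indRep_le fun g x hx => ?_
      change indTrivEquiv e _ ∈ indSub (trivLattice e)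
      rw [map_smul, indTrivEquiv_toIndExt]
      exact single_mul_incl_mem_indSub (single_mul_mem_trivLattice e) g
        ((apply_mem_trivLattice e).2 hx)
    exact fun hx => h hx

theorem mem_assocOrder_indRep {a : F[G]} : a ∈ assocOrder F (indRep ρ) ↔
    ∀ x ∈ indSub (trivLattice e), a * x ∈ indSub (trivLattice e) :=
  mem_associatedOrder_iff (indTrivEquiv e) fun _ => indTrivEquiv_mem e

/-- The induced lattice is the sum of the translates `gX`, and `b` maps `X` into it exactly when all
the `F[H]`-components of `b` map `X` into itself. Apply this to `b = ag`. -/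
theorem mem_assocOrder_indRep_iff (e : ScalarExt F ρ ≃ₗ[F[H]] F[H]) {a : F[G]} : a ∈ assocOrder F (indRep ρ) ↔
    ∀ g : G, a * MonoidAlgebra.single g 1 ∈ indSub (Subalgebra.toSubmodule (assocOrder F ρ)) := by
  have key : ∀ b : F[G], b ∈ indSub (Subalgebra.toSubmodule (assocOrder F ρ)) ↔
      ∀ x ∈ trivLattice e, b * incl F H x ∈ indSub (trivLattice e) := by
    intro b
    simp only [mem_indSub, Subalgebra.mem_toSubmodule, mem_assocOrder e, ← mul_assoc,
      restrict_mul_incl]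
    exact ⟨fun h x hx g => h g x hx, fun h g x hx => h x hx g⟩
  simp only [key]
  rw [mem_assocOrder_indRep e]
  constructor
  · intro ha g x hx
    rw [mul_assoc]
    exact ha _ (single_mul_incl_mem_indSub (single_mul_mem_trivLattice e) g hx)
  · intro ha
    have h : indSub (trivLattice e) ≤ (indSub (trivLattice e)).comap (LinearMap.mulLeft R a) :=
      indSub_le fun g x hx => by
        have := ha g x hx
        rwa [mul_assoc] at this
    intro x hx
    exact h hx

theorem indAssocOrder_eq : indAssocOrder F ρ =
    indSub (Subalgebra.toSubmodule (assocOrder F ρ)) := by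
  have hmk : ∀ (g : G) (a : assocOrder F ρ),
      indAssocMap F ρ (Representation.IndV.mk H.subtype (assocOrderRep F ρ) g a) =
        MonoidAlgebra.single g⁻¹ 1 * incl F H (a : F[H]) := indAssocMap_mk F ρ
  have hA : ∀ (h : H), ∀ a ∈ Subalgebra.toSubmodule (assocOrder F ρ),
      MonoidAlgebra.single h 1 * a ∈ Subalgebra.toSubmodule (assocOrder F ρ) := fun h a ha =>
    (assocOrder F ρ).mul_mem (single_mem_assocOrder F ρ h) ha
  refine le_antisymm ?_ ?_
  · rw [indAssocOrder, ← Submodule.ker_mkQ (indSub _), LinearMap.range_le_ker_iff]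
    refine Representation.IndV.hom_ext _ _ fun g => LinearMap.ext fun a => ?_
    refine (Submodule.Quotient.mk_eq_zero _).2 ?_
    have := single_mul_incl_mem_indSub hA g⁻¹ a.2
    rwa [← hmk] at this
  · refine indSub_le fun g a ha => ⟨Representation.IndV.mk H.subtype _ g⁻¹ ⟨a, ha⟩, ?_⟩
    rw [hmk, inv_inv]

end Induction

/-! ### Dual bases of projective lattices -/

section Projective

variable {R F A V : Type*} [CommRing R] [Field F] [Algebra R F] [Ring A]
  [Algebra R A] [Algebra F A] [IsScalarTower R F A] [AddCommGroup V] [Module R V] [Module A V]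
  [IsScalarTower R A V]

/-- A dual basis of a projective lattice `L` of rank one is given by right multiplications. -/
theorem exists_dualBasis_of_projective [IsDomain R] [IsFractionRing R F] (e : V ≃ₗ[A] A)
    (L : Submodule R V)
    (hB : ∀ a : A, ∃ s : R, s ≠ 0 ∧ s • a ∈ associatedOrder A L)
    (hL : ∃ s : R, s ≠ 0 ∧ s • e.symm 1 ∈ L)
    [Module.Projective (associatedOrder A L) (latticeModule A L)] :
    ∃ (t : Finset (latticeModule A L)) (c : latticeModule A L → A),
      (∀ j, ∀ x ∈ L, e x * c j ∈ associatedOrder A L) ∧ ∑ j ∈ t, c j * e j = 1 := by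
  obtain ⟨σ, hσ⟩ := Module.Projective.out (R := associatedOrder A L) (P := latticeModule A L)
  obtain ⟨s, hs, hu⟩ := hL
  have hne : ∀ {w : R}, w ≠ 0 → algebraMap R F w ≠ 0 := fun hw =>
    (map_ne_zero_iff _ (IsFractionRing.injective R F)).2 hw
  let u : latticeModule A L := ⟨s • e.symm 1, hu⟩
  have heR : ∀ (w : R) (x : V), e (w • x) = w • e x := fun w x => by
    rw [← algebraMap_smul A w x, map_smul, algebraMap_smul]
  have heu : e u = s • 1 := by
    change e (s • e.symm 1) = _
    rw [heR, e.apply_symm_apply]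
  -- `σ` is a section of the canonical map from the free module on the lattice. The vector
  -- corresponding to `1` may lie outside the lattice, so `σ` is evaluated at its multiple `u` by
  -- `s`, and `s` is divided out.
  refine ⟨(σ u).support, fun j => (algebraMap R F s)⁻¹ • (σ u j : A), fun j x hx => ?_, ?_⟩
  · obtain ⟨w, hw, hwx⟩ := hB (e x)
    -- `e x` need not be in the order, but `w • e x` is. Linearity of `σ` applied to this identity,
    -- after cancelling `w` and `s`, gives `e x * c j = σ x j`.
    have h1 : (⟨w • e x, hwx⟩ : associatedOrder A L) • u =
        algebraMap R (associatedOrder A L) (w * s) • (⟨x, hx⟩ : latticeModule A L) := by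
      refine Subtype.ext (e.injective ?_)
      change e ((w • e x) • (u : V)) = e ((algebraMap R A (w * s)) • x)
      rw [map_smul, heu, algebraMap_smul, heR, smul_eq_mul, mul_smul_comm, mul_one, smul_smul,
        mul_comm]
    have h2 := congrArg (fun z => ((σ z j : associatedOrder A L) : A)) h1
    simp only [map_smul, Finsupp.smul_apply, smul_eq_mul, Subalgebra.coe_mul,
      Subalgebra.coe_algebraMap] at h2
    have h3 : e x * (algebraMap R F s)⁻¹ • (σ u j : A) = σ ⟨x, hx⟩ j := by
      rw [← Algebra.smul_def, ← algebraMap_smul F w, ← algebraMap_smul F (w * s), map_mul,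
        smul_mul_assoc, mul_smul] at h2
      have h4 := (smul_right_injective A (hne hw)) h2
      rw [mul_smul_comm, h4, smul_smul, inv_mul_cancel₀ (hne hs), one_smul]
    rw [h3]
    exact (σ ⟨x, hx⟩ j).2
  · have h1 := congrArg (fun z : latticeModule A L => e z) (hσ u)
    simp only [Finsupp.linearCombination_apply, Finsupp.sum, id, Submodule.coe_sum,
      map_sum] at h1
    have h2 : ∀ j : latticeModule A L,
        e ((σ u j • j : latticeModule A L) : V) = (σ u j : A) * e j := fun j =>
      map_smul e (σ u j : A) (j : V)
    simp only [h2, heu] at h1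
    simp only [smul_mul_assoc]
    rw [← Finset.smul_sum, h1, ← algebraMap_smul F s, smul_smul, inv_mul_cancel₀ (hne hs),
      one_smul]

theorem exists_smul_mem_of_single_mem {Γ : Type*} [IsDomain R] [IsFractionRing R F]
    {S : Submodule R F[Γ]} (hS : ∀ g : Γ, MonoidAlgebra.single g 1 ∈ S) (x : F[Γ]) :
    ∃ s : R, s ≠ 0 ∧ s • x ∈ S := by
  induction x using MonoidAlgebra.induction_linear with
  | zero => exact ⟨1, one_ne_zero, by simp⟩
  | add x y hx hy =>
    obtain ⟨s, hs, hx⟩ := hx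
    obtain ⟨t, ht, hy⟩ := hy
    refine ⟨s * t, mul_ne_zero hs ht, ?_⟩
    rw [smul_add]
    refine Submodule.add_mem _ ?_ ?_
    · rw [mul_comm, mul_smul]
      exact Submodule.smul_mem _ _ hx
    · rw [mul_smul]
      exact Submodule.smul_mem _ _ hy
  | single g c =>
    obtain ⟨a, s, hs, rfl⟩ := IsFractionRing.div_surjective (A := R) c
    refine ⟨s, nonZeroDivisors.ne_zero hs, ?_⟩
    have hs0 : algebraMap R F s ≠ 0 :=
      (map_ne_zero_iff _ (IsFractionRing.injective R F)).2 (nonZeroDivisors.ne_zero hs)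
    have h : s • MonoidAlgebra.single g (algebraMap R F a / algebraMap R F s) =
        a • MonoidAlgebra.single g (1 : F) := by
      rw [MonoidAlgebra.smul_single, MonoidAlgebra.smul_single, Algebra.smul_def,
        Algebra.smul_def, mul_div_cancel₀ _ hs0, mul_one]
    rw [h]
    exact Submodule.smul_mem _ _ (hS g)

end Projective

/-! ### Linear independence with coefficients in the ambient algebra -/

section Subalgebra

variable {R A V κ : Type*} [CommRing R] [Ring A] [Algebra R A] [AddCommGroup V] [Module A V]

theorem linearIndependent_subalgebra_iff {B : Subalgebra R A} {L : Submodule B V} {v : κ → L} :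
    LinearIndependent B v ↔ ∀ (t : Finset κ) (β : κ → A), (∀ k, β k ∈ B) →
      ∑ k ∈ t, β k • (v k : V) = 0 → ∀ k ∈ t, β k = 0 := by
  rw [linearIndependent_iff']
  refine forall_congr' fun t => ⟨fun h β hβ h0 k hk => ?_, fun h β h0 k hk => ?_⟩
  · refine congrArg Subtype.val (h (fun k => ⟨β k, hβ k⟩) (Subtype.ext ?_) k hk)
    rw [Submodule.coe_sum]
    exact h0
  · refine Subtype.ext (h (fun k => β k) (fun k => (β k).2) ?_ k hk)
    have := congrArg Subtype.val h0
    rw [Submodule.coe_sum] at this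
    exact this

end Subalgebra

/-! ### Freeness and projectivity of the induced lattice -/

section Induction

variable {R F G M : Type*} [CommRing R] [Field F] [Algebra R F] [Group G]
  {H : Subgroup G} [AddCommGroup M] [Module R M] {ρ : Representation R H M}

/-- If the associated order of `Ind_H^G M` is induced from the associated order of `M`, then a
basis of `M` gives a basis of `Ind_H^G M`. -/
theorem free_assocModule_indRep [Finite G] (e : ScalarExt F ρ ≃ₗ[F[H]] F[H])
    (hB : ∀ x, x ∈ assocOrder F (indRep ρ) ↔
      x ∈ indSub (Subalgebra.toSubmodule (assocOrder F ρ)))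
    [Module.Free (assocOrder F ρ) (assocModule F ρ)] :
    Module.Free (assocOrder F (indRep ρ)) (assocModule F (indRep ρ)) := by
  let b := Module.Free.chooseBasis (assocOrder F ρ) (assocModule F ρ)
  have hv : ∀ x ∈ lattice F ρ, toIndExt F ρ x ∈ lattice F (indRep ρ) := fun x hx => by
    have := single_smul_toIndExt_mem_lattice 1 hx
    rwa [← MonoidAlgebra.one_def, one_smul] at this
  let v : Module.Free.ChooseBasisIndex (assocOrder F ρ) (assocModule F ρ) →
      assocModule F (indRep ρ) := fun k => ⟨toIndExt F ρ (b k), hv _ (b k).2⟩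
  have hincl : ∀ a ∈ assocOrder F ρ, incl F H a ∈ assocOrder F (indRep ρ) := by
    intro a ha
    rw [hB]
    intro g
    rw [restrict_mul_incl]
    by_cases hg : g ∈ H
    · rw [restrict_single_mem ⟨g, hg⟩]
      exact (assocOrder F ρ).mul_mem (single_mem_assocOrder F ρ _) ha
    · rw [restrict_single_notMem hg, zero_mul]
      exact (assocOrder F ρ).zero_mem
  have hli : LinearIndependent (assocOrder F (indRep ρ)) v := by
    refine linearIndependent_subalgebra_iff.2 fun t β hβ h0 k hk => ?_
    have h1 : ∑ k ∈ t, β k * incl F H (e (b k)) = 0 := by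
      have := congrArg (indTrivEquiv e) h0
      rw [map_sum, map_zero] at this
      rw [← this]
      refine Finset.sum_congr rfl fun k _ => ?_
      rw [map_smul, smul_eq_mul, indTrivEquiv_toIndExt]
    -- Each `F[H]`-component of the relation is a relation between the basis vectors of `M`, with
    -- coefficients in its associated order by `hB`.
    have h2 : ∀ g : G, restrict F H (MonoidAlgebra.single g 1 * β k) = 0 := by
      intro g
      refine linearIndependent_subalgebra_iff.1 b.linearIndependent t
        (fun k => restrict F H (MonoidAlgebra.single g 1 * β k))
        (fun k => (hB _).1 (hβ k) g) (e.injective ?_) k hk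
      rw [map_sum, map_zero]
      have h4 := congrArg (fun z => restrict F H (MonoidAlgebra.single g 1 * z)) h1
      simp only [Finset.mul_sum, map_sum, mul_zero, map_zero, ← mul_assoc,
        restrict_mul_incl] at h4
      rw [← h4]
      refine Finset.sum_congr rfl fun k _ => ?_
      rw [map_smul, smul_eq_mul]
    refine MonoidAlgebra.ext (Finsupp.ext fun g => ?_)
    have h5 := congrArg (fun z : F[H] => z.coeff 1) (h2 g⁻¹)
    simpa [coeff_restrict, MonoidAlgebra.coeff_single_mul_apply] using h5
  have hsp : ⊤ ≤ Submodule.span (assocOrder F (indRep ρ)) (Set.range v) := by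
    let T : Submodule (assocOrder F (indRep ρ)) (ScalarExt F (indRep ρ)) :=
      (Submodule.span (assocOrder F (indRep ρ)) (Set.range v)).map
        (assocModule F (indRep ρ)).subtype
    -- Quantifying over `β` lets the scalar step of the induction absorb `incl F H a` into `β`.
    have h1 : ∀ x : assocModule F ρ, ∀ β ∈ assocOrder F (indRep ρ),
        β • toIndExt F ρ x ∈ T := by
      intro x
      have hx : x ∈ Submodule.span (assocOrder F ρ) (Set.range b) := by
        rw [b.span_eq]
        trivial
      induction hx using Submodule.span_induction with
      | mem x hx =>
        obtain ⟨k, rfl⟩ := hx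
        exact fun β hβ => T.smul_mem ⟨β, hβ⟩ ⟨v k, Submodule.subset_span ⟨k, rfl⟩, rfl⟩
      | zero =>
        intro β _
        rw [Submodule.coe_zero, map_zero, smul_zero]
        exact T.zero_mem
      | add x y _ _ hx hy =>
        intro β hβ
        rw [Submodule.coe_add, map_add, smul_add]
        exact T.add_mem (hx β hβ) (hy β hβ)
      | smul a x _ hx =>
        intro β hβ
        change β • toIndExt F ρ ((a : F[H]) • (x : ScalarExt F ρ)) ∈ T
        rw [← incl_smul_toIndExt, ← mul_smul]
        exact hx _ (Subalgebra.mul_mem _ hβ (hincl _ a.2))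
    let S : Submodule R (ScalarExt F (indRep ρ)) :=
      { carrier := T
        add_mem' := T.add_mem
        zero_mem' := T.zero_mem
        smul_mem' := fun c x hx => by
          have h : algebraMap R F[G] c • x = c • x := algebraMap_smul F[G] c x
          rw [← h]
          exact T.smul_mem (algebraMap R (assocOrder F (indRep ρ)) c) hx }
    have hS : lattice F (indRep ρ) ≤ S := lattice_indRep_le fun g x hx =>
      h1 ⟨x, hx⟩ _ (single_mem_assocOrder F (indRep ρ) g)
    intro x _
    obtain ⟨y, hy, hyx⟩ := hS x.2
    rwa [← Subtype.ext hyx]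
  exact Module.Free.of_basis (Module.Basis.mk hli hsp)

theorem mul_comm_of_isMulCommutative (hH : IsMulCommutative H) (a b : F[H]) : a * b = b * a := by
  induction a using MonoidAlgebra.induction_linear with
  | zero => simp
  | add a a' ha ha' => rw [add_mul, mul_add, ha, ha']
  | single h c =>
    exact MonoidAlgebra.single_commute (fun k => hH.is_comm.comm h k) (fun d => mul_comm c d) b

/-- For commutative `F[H]`, if `Ind_H^G M` is projective over its associated order and that order
is stable under the projection to `F[H]`, then the associated order contains that of `M`. -/
theorem incl_mem_assocOrder_indRep [Finite G] [IsDomain R] [IsFractionRing R F]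
    (e : ScalarExt F ρ ≃ₗ[F[H]] F[H]) (hH : IsMulCommutative H)
    (hB : ∀ x ∈ assocOrder F (indRep ρ), incl F H (restrict F H x) ∈ assocOrder F (indRep ρ))
    [Module.Projective (assocOrder F (indRep ρ)) (assocModule F (indRep ρ))]
    {a : F[H]} (ha : a ∈ assocOrder F ρ) : incl F H a ∈ assocOrder F (indRep ρ) := by
  have := Fintype.ofFinite (G ⧸ H)
  obtain ⟨t, c, hc, hsum⟩ := exists_dualBasis_of_projective (F := F) (indTrivEquiv e)
    (lattice F (indRep ρ))
    (exists_smul_mem_of_single_mem (S := Subalgebra.toSubmodule (assocOrder F (indRep ρ)))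
      (single_mem_assocOrder F (indRep ρ)))
    (exists_smul_mem_lattice _)
  have h1 := congrArg (restrict F H) hsum
  rw [map_sum, restrict_one] at h1
  rw [Finset.sum_congr rfl fun j _ => restrict_mul (c j) _] at h1
  -- `a` is multiplied by the projection of the dual basis identity, expanded over `G ⧸ H`.
  rw [← mul_one a, ← h1]
  simp only [Finset.mul_sum, map_sum]
  refine Subalgebra.sum_mem _ fun j _ => Subalgebra.sum_mem _ fun q _ => ?_
  have hl : a * restrict F H (MonoidAlgebra.single (q.out)⁻¹ 1 * indTrivEquiv e j) ∈
      trivLattice e :=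
    (mem_assocOrder e).1 ha _ ((indTrivEquiv_mem e).2 j.2 _)
  -- Commutativity brings the lattice component next to `a`. The product is again in the lattice of
  -- `M`, hence in the induced one, and right multiplication by `c j` sends it into the associated
  -- order.
  rw [mul_comm_of_isMulCommutative hH (restrict F H (c j * _)), ← mul_assoc, ← restrict_incl_mul,
    ← mul_assoc]
  refine hB _ (Subalgebra.mul_mem _ ?_ (single_mem_assocOrder F (indRep ρ) _))
  have h2 := single_mul_incl_mem_indSub (single_mul_mem_trivLattice e) 1 hl
  rw [← MonoidAlgebra.one_def, one_mul] at h2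
  have h3 := hc j ((indTrivEquiv e).symm _) ((indTrivEquiv_mem e).1
    (by rwa [LinearEquiv.apply_symm_apply]))
  rwa [LinearEquiv.apply_symm_apply] at h3

theorem incl_trace [Finite G] {P : Subgroup G} (hP : P ≤ H) :
    incl F H (trace F (P.subgroupOf H)) = trace F P := by
  classical
  refine MonoidAlgebra.ext (Finsupp.ext fun g => ?_)
  rw [coeff_trace]
  by_cases hg : g ∈ H
  · rw [coeff_incl _ ⟨g, hg⟩, coeff_trace]
    rfl
  · rw [coeff_incl_notMem _ hg, if_neg fun h => hg (hP h)]

theorem normal_of_normalClosure_le {P : Subgroup G} (h : Subgroup.normalClosure (P : Set G) ≤ P) :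
    P.Normal := by
  rw [← le_antisymm h Subgroup.le_normalClosure]
  exact Subgroup.normalClosure_normal

end Induction

/-! ### Trace sums under the projection to `F[H]` -/

section TraceSum

variable {R F G : Type*} [CommRing R] [Field F] [Algebra R F] [Group G] [Finite G]
  {H : Subgroup G} {π : R} {r : ℕ} {n : Fin (r + 1) → ℕ} {P : Fin (r + 1) → Subgroup G}

/-- A left coset of `P i` is contained in `H` or disjoint from it, so setting the coefficients
outside `H` to zero preserves the congruences. It is applied to the normal closures. -/
theorem incl_restrict_mem_traceSum (hπ : algebraMap R F π ≠ 0) (hn : Monotone n) (hP0 : P 0 = ⊥)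
    (hP : Monotone P) (hPH : ∀ i, P i ≤ H) {x : F[G]} (hx : x ∈ traceSum F π n P) :
    incl F H (restrict F H x) ∈ traceSum F π n P := by
  rw [mem_traceSum F hπ hn hP0 hP] at hx ⊢
  refine ⟨fun g => ?_, fun i g k hk => ?_⟩
  · by_cases hg : g ∈ H
    · rw [coeff_incl _ ⟨g, hg⟩]
      exact hx.1 g
    · rw [coeff_incl_notMem _ hg]
      exact Submodule.zero_mem _
  · by_cases hg : g ∈ H
    · rw [coeff_incl _ ⟨g, hg⟩, coeff_incl _ ⟨g * k, H.mul_mem hg (hPH _ hk)⟩]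
      exact hx.2 i g k hk
    · rw [coeff_incl_notMem _ hg, coeff_incl_notMem _ fun h => hg
        ((H.mul_mem_cancel_right (hPH _ hk)).1 h), sub_zero]
      exact Submodule.zero_mem _

end TraceSum

end GaloisLattice

end

/-! ### The five claims -/

theorem mainTheorem6 {R F G M : Type*}
    [CommRing R] [IsDomain R] [IsDiscreteValuationRing R] [Finite (IsLocalRing.ResidueField R)]
    [Field F] [CharZero F] [Algebra R F] [IsFractionRing R F]
    (π : R) (hπ : Irreducible π)
    [Group G] [Finite G] (H : Subgroup G)
    [AddCommGroup M] [Module R M] [Module.Finite R M] [Module.IsTorsionFree R M]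
    (ρ : Representation R H M)
    (hM : Nonempty (GaloisLattice.ScalarExt F ρ ≃ₗ[F[H]] F[H]))
    (r : ℕ) (n : Fin (r + 1) → ℕ) (hn0 : n 0 = 0) (hn : StrictMono n)
    (P : Fin (r + 1) → Subgroup G) (hP0 : P 0 = ⊥) (hP : StrictMono P) (hPH : ∀ i, P i ≤ H)
    (hA : Subalgebra.toSubmodule (GaloisLattice.assocOrder F ρ) =
      GaloisLattice.traceSum F π n (fun i => (P i).subgroupOf H)) :
    GaloisLattice.indAssocOrder F ρ = GaloisLattice.traceSum F π n P ∧
    Subalgebra.toSubmodule (GaloisLattice.assocOrder F (GaloisLattice.indRep ρ)) =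
      GaloisLattice.traceSum F π n (fun i => Subgroup.normalClosure (P i : Set G)) ∧
    ((∃ S : Subring F[G], (S : Set F[G]) = GaloisLattice.indAssocOrder F ρ) ↔
      ∀ i, (P i).Normal) ∧
    ((∀ i, (P i).Normal) →
      Module.Free (GaloisLattice.assocOrder F ρ) (GaloisLattice.assocModule F ρ) →
      (∃ L : Submodule (GaloisLattice.assocOrder F (GaloisLattice.indRep ρ)) F[G],
        (L : Set F[G]) = GaloisLattice.indAssocOrder F ρ ∧
        Module.Free (GaloisLattice.assocOrder F (GaloisLattice.indRep ρ)) L) ∧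
      Module.Free (GaloisLattice.assocOrder F (GaloisLattice.indRep ρ))
        (GaloisLattice.assocModule F (GaloisLattice.indRep ρ))) ∧
    (IsMulCommutative H → H.Normal →
      Module.Projective (GaloisLattice.assocOrder F (GaloisLattice.indRep ρ))
        (GaloisLattice.assocModule F (GaloisLattice.indRep ρ)) →
      ∀ i, (P i).Normal) := by
  obtain ⟨e⟩ := hM
  have hπ0 : algebraMap R F π ≠ 0 :=
    (map_ne_zero_iff _ (IsFractionRing.injective R F)).2 hπ.ne_zero
  have hsub : GaloisLattice.indSub (Subalgebra.toSubmodule (GaloisLattice.assocOrder F ρ)) =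
      GaloisLattice.traceSum F π n P := by
    rw [hA, GaloisLattice.indSub_traceSum hπ0 hn.monotone hP0 hP.monotone hPH]
  have h1 : GaloisLattice.indAssocOrder F ρ = GaloisLattice.traceSum F π n P := by
    rw [GaloisLattice.indAssocOrder_eq, hsub]
  have h2 : Subalgebra.toSubmodule (GaloisLattice.assocOrder F (GaloisLattice.indRep ρ)) =
      GaloisLattice.traceSum F π n (fun i => Subgroup.normalClosure (P i : Set G)) := by
    ext x
    rw [Subalgebra.mem_toSubmodule, GaloisLattice.mem_assocOrder_indRep_iff e, hsub,
      GaloisLattice.forall_mul_single_mem_traceSum hπ0 hn.monotone hP0 hP.monotone]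
  have hncl0 : Subgroup.normalClosure (P 0 : Set G) = ⊥ := by
    rw [hP0, Subgroup.normalClosure_eq_bot_iff, Subgroup.coe_bot]
  have hncl : Monotone fun i => Subgroup.normalClosure (P i : Set G) := fun i j hij =>
    Subgroup.normalClosure_mono (hP.monotone hij)
  have hnormal : ∀ i, ((algebraMap R F π) ^ n i)⁻¹ • GaloisLattice.trace F (P i) ∈
      GaloisLattice.traceSum F π n (fun i => Subgroup.normalClosure (P i : Set G)) →
      (P i).Normal := fun i hi => GaloisLattice.normal_of_normalClosure_le
    (GaloisLattice.le_of_trace_mem_traceSum hπ hn hncl0 hncl i hi)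
  have heq : (∀ i, (P i).Normal) → GaloisLattice.indAssocOrder F ρ =
      Subalgebra.toSubmodule (GaloisLattice.assocOrder F (GaloisLattice.indRep ρ)) := by
    intro hN
    rw [h1, h2]
    congr 1
    ext1 i
    have := hN i
    rw [Subgroup.normalClosure_eq_self]
  refine ⟨h1, h2, ⟨?_, fun hN => ?_⟩, fun hN hfree => ⟨?_, ?_⟩, fun hH hHG hproj i => ?_⟩
  · rintro ⟨S, hS⟩ i
    refine hnormal i ?_
    rw [← GaloisLattice.forall_mul_single_mem_traceSum hπ0 hn.monotone hP0 hP.monotone]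
    intro g
    have hmem : ∀ x, x ∈ S ↔ x ∈ GaloisLattice.traceSum F π n P := fun x => by
      rw [← SetLike.mem_coe, hS, h1, SetLike.mem_coe]
    -- The ring contains the scaled trace and every `g`, hence the right translates of the trace.
    refine (hmem _).1 (S.mul_mem ((hmem _).2 (GaloisLattice.trace_mem_traceSum i))
      ((hmem _).2 ?_))
    rw [← hsub]
    have := GaloisLattice.single_mul_incl_mem_indSub
      (N := Subalgebra.toSubmodule (GaloisLattice.assocOrder F ρ))
      (fun h a ha => (GaloisLattice.assocOrder F ρ).mul_mem
        (GaloisLattice.single_mem_assocOrder F ρ h) ha) g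
      (GaloisLattice.assocOrder F ρ).one_mem
    rwa [map_one, mul_one] at this
  · refine ⟨(GaloisLattice.assocOrder F (GaloisLattice.indRep ρ)).toSubring, ?_⟩
    rw [heq hN]
    rfl
  -- For normal `P i` the induced module equals the associated order, so it is free on `1`.
  · let f := LinearMap.toSpanSingleton (GaloisLattice.assocOrder F (GaloisLattice.indRep ρ))
      F[G] 1
    have hf : ∀ x, f x = (x : F[G]) := fun x => mul_one (x : F[G])
    refine ⟨LinearMap.range f, ?_, Module.Free.of_equiv (LinearEquiv.ofInjective f ?_)⟩
    · rw [heq hN]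
      ext x
      constructor
      · rintro ⟨y, rfl⟩
        rw [hf]
        exact y.2
      · exact fun hx => ⟨⟨x, hx⟩, hf _⟩
    · intro x y hxy
      rw [hf, hf] at hxy
      exact Subtype.ext hxy
  · refine GaloisLattice.free_assocModule_indRep e fun x => ?_
    rw [← GaloisLattice.indAssocOrder_eq, heq hN, Subalgebra.mem_toSubmodule]
  · refine hnormal i ?_
    have hB : ∀ x, x ∈ GaloisLattice.assocOrder F (GaloisLattice.indRep ρ) ↔
        x ∈ GaloisLattice.traceSum F π n
          (fun i => Subgroup.normalClosure (P i : Set G)) := fun x => by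
      rw [← h2, Subalgebra.mem_toSubmodule]
    have hA' : ((algebraMap R F π) ^ n i)⁻¹ • GaloisLattice.trace F ((P i).subgroupOf H) ∈
        GaloisLattice.assocOrder F ρ := by
      rw [← Subalgebra.mem_toSubmodule, hA]
      exact GaloisLattice.trace_mem_traceSum (P := fun i => (P i).subgroupOf H) i
    have := GaloisLattice.incl_mem_assocOrder_indRep e hH (fun x hx => by
      rw [hB] at hx ⊢
      exact GaloisLattice.incl_restrict_mem_traceSum hπ0 hn.monotone hncl0 hncl
        -- Normality of `H` keeps the normal closures inside `H`, so the associated order is stable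
        -- under the projection.
        (fun i => Subgroup.normalClosure_le_normal (hPH i)) hx) hA'
    rwa [map_smul, GaloisLattice.incl_trace (hPH i), hB] at this
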